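/- Let $n,k\ge 0$ be integers and let $H=\{x\in\mathbb{R}^{n+1}:\sum_{i=1}^{n+1}x(i)=0\}$, with $\pi:\mathbb{R}^{n+1}\to H$ the orthogonal projection and $e_1,\dots,e_{n+1}$ the standard basis of $\mathbb{R}^{n+1}$. Let $\mathbb{M}_Z^n$ be the space $H$ with the norm $\|x\|_Z=\tfrac12\bigl(\max_i x(i)-\min_i x(i)\bigr)$; its unit ball is the zonotope $Z_n=\pi([-1,1]^{n+1})$. A signed set is a vector $X\in\{0,\pm1\}^{n+1}$; put $X^+=\{i:X(i)=1\}$, $X^-=\{i:X(i)=-1\}$, $X^0=\{i:X(i)=0\}$. For every signed set $X$ that is the sign vector of some element of $H$, let $$F(X)=\sum_{i\in X^+}\pi(e_i)-\sum_{j\in X^-}\pi(e_j)+\sum_{l\in X^0}[-\pi(e_l),\pi(e_l)]$$ (a Minkowski sum); these are the non-empty faces of $Z_n$. A Steiner tree of a finite set $N\subseteq\mathbb{M}_Z^n$ is a tree whose vertex set is a finite set of points of $\mathbb{M}_Z^n$ containing $N$; its length is the sum of $\|x-y\|_Z$ over its edges $xy$; a Steiner minimal tree (SMT) of $N$ is a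 Steiner tree of $N$ of minimum length. Let $p_1,\dots,p_k$ be distinct points of $\mathbb{M}_Z^n\setminus\{o\}$, and for each $i$ let $X_i$ be the signed set, occurring as the sign vector of an element of $H$, such that $\|p_i\|_Z^{-1}p_i$ lies in the relative interior of $F(X_i)$. For $I\subseteq\{1,\dots,k\}$, call the tree with vertex set $\{o\}\cup\{p_i:i\in I\}$ in which $o$ is joined to each $p_i$, $i\in I$, the star connecting $\{p_i:i\in I\}$ to $o$. Write $P=\{p_1,\dots,p_k\}$. 1. The star connecting $P$ to $o$ is an SMT of $P\cup\{o\}$ if and only if there do not exist indices $a,b,c,d\in\{1,\dots,k\}$ with $\{a,b\}\cap\{c,d\}=\emptyset$ and $(X_a^+\cup X_c^+)\cap(X_b^-\cup X_d^-)=\emptyset$. 2. Consequently, the star connecting $P$ to $o$ is an SMT of $P\cup\{o\}$ if and only if for every $I\subseteq\{1,\dots,k\}$ with $2\le|I|\le4$ the star connecting $\{p_i:i\in I\}$ to $o$ is an SMT of $\{p_i:i\in I\}\cup\{o\}$. -/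

import Mathlib

open scoped Pointwise

noncomputable section

/-! ### Steiner minimal trees in a normed space -/

/-- The length of a graph `G` whose vertices are the points of a finite set `V` of a normed space:
the sum of `‖x - y‖` over the edges `xy` of `G`. -/
def graphLength {E : Type*} [NormedAddCommGroup E] {V : Finset E} (G : SimpleGraph V) : ℝ :=
  open Classical in
  ∑ e ∈ G.edgeFinset, Sym2.lift ⟨fun x y : V => ‖(x : E) - (y : E)‖, fun _ _ => norm_sub_rev _ _⟩ e

/-- `(V, G)` is a Steiner tree of the finite set of points `N`: a tree with finite vertex set
`V ⊇ N`. -/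
def IsSteinerTree {E : Type*} (N V : Finset E) (G : SimpleGraph V) : Prop :=
  N ⊆ V ∧ G.IsTree

/-- `(V, G)` is a Steiner minimal tree of `N`: a Steiner tree of `N` of least length. -/
def IsSMT {E : Type*} [NormedAddCommGroup E] (N V : Finset E) (G : SimpleGraph V) : Prop :=
  IsSteinerTree N V G ∧
    ∀ (V' : Finset E) (G' : SimpleGraph V'), IsSteinerTree N V' G' → graphLength G ≤ graphLength G'

/-- The star with vertex set `P ∪ {o}` joining `o` to every other point of `P`. -/
def starAtOrigin {E : Type*} [Zero E] [DecidableEq E] (P : Finset E) :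
    SimpleGraph (insert (0 : E) P : Finset E) :=
  SimpleGraph.starGraph ⟨0, Finset.mem_insert_self 0 P⟩

/-- The star connecting `P` to the origin `o` is a Steiner minimal tree of `P ∪ {o}`. -/
def StarIsSMT {E : Type*} [NormedAddCommGroup E] [DecidableEq E] (P : Finset E) : Prop :=
  IsSMT (insert (0 : E) P) (insert (0 : E) P) (starAtOrigin P)

/-! ### The Minkowski space `M_Z^n` -/

/-- The hyperplane `H = {x ∈ ℝ^{n+1} : ∑ x(i) = 0}`. -/
def hyperplaneH (n : ℕ) : Submodule ℝ (EuclideanSpace ℝ (Fin (n + 1))) where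
  carrier := {x | ∑ i, x i = 0}
  add_mem' := by
    intro a b ha hb
    simp only [Set.mem_ofPred_eq] at ha hb ⊢
    simp [Finset.sum_add_distrib, ha, hb]
  zero_mem' := by simp
  smul_mem' := by
    intro c x hx
    simp only [Set.mem_ofPred_eq] at hx ⊢
    simp [← Finset.mul_sum, hx]

/-- The underlying space of `M_Z^n`: the hyperplane `H`, which gets below the norm
`½ (max x(i) - min x(i))` and not the Euclidean one. -/
def MZ (n : ℕ) : Type := hyperplaneH n

namespace MZ

instance (n : ℕ) : AddCommGroup (MZ n) := inferInstanceAs (AddCommGroup (hyperplaneH n))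

instance (n : ℕ) : Module ℝ (MZ n) := inferInstanceAs (Module ℝ (hyperplaneH n))

/-- The identity map from the hyperplane `H` to `M_Z^n`. -/
def ofH (n : ℕ) : hyperplaneH n ≃ₗ[ℝ] MZ n := LinearEquiv.refl ℝ (hyperplaneH n)

/-- The `i`th coordinate of a point of `M_Z^n`. -/
def coord {n : ℕ} (x : MZ n) (i : Fin (n + 1)) : ℝ := ((ofH n).symm x : EuclideanSpace ℝ _) i

/-- `‖x‖_Z = ½ (max x(i) - min x(i))`. -/
instance (n : ℕ) : Norm (MZ n) := ⟨fun x => ((⨆ i, x.coord i) - ⨅ i, x.coord i) / 2⟩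

theorem norm_def {n : ℕ} (x : MZ n) : ‖x‖ = ((⨆ i, x.coord i) - ⨅ i, x.coord i) / 2 := rfl

@[simp] theorem coord_add {n : ℕ} (x y : MZ n) (i : Fin (n + 1)) :
    (x + y).coord i = x.coord i + y.coord i := by simp [coord]

@[simp] theorem coord_smul {n : ℕ} (c : ℝ) (x : MZ n) (i : Fin (n + 1)) :
    (c • x).coord i = c * x.coord i := by simp [coord]

@[simp] theorem coord_zero {n : ℕ} (i : Fin (n + 1)) : (0 : MZ n).coord i = 0 := by simp [coord]

theorem sum_coord {n : ℕ} (x : MZ n) : ∑ i, x.coord i = 0 := ((ofH n).symm x).2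

theorem coord_ext {n : ℕ} {x y : MZ n} (h : ∀ i, x.coord i = y.coord i) : x = y := by
  apply (ofH n).symm.injective
  ext i
  exact h i

theorem coord_le {n : ℕ} (x : MZ n) (i : Fin (n + 1)) : x.coord i ≤ ⨆ i, x.coord i :=
  le_ciSup (Set.finite_range _).bddAbove i

theorem le_coord {n : ℕ} (x : MZ n) (i : Fin (n + 1)) : ⨅ i, x.coord i ≤ x.coord i :=
  ciInf_le (Set.finite_range _).bddBelow i

theorem norm_le_iff {n : ℕ} (x : MZ n) (r : ℝ) :
    ‖x‖ ≤ r ↔ ∀ i j, x.coord i - x.coord j ≤ 2 * r := by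
  rw [norm_def]
  constructor
  · intro h i j
    linarith [coord_le x i, le_coord x j]
  · intro h
    have h1 : (⨆ i, x.coord i) ≤ 2 * r + ⨅ i, x.coord i := by
      refine ciSup_le fun i => ?_
      have : x.coord i - 2 * r ≤ ⨅ i, x.coord i := le_ciInf fun j => by linarith [h i j]
      linarith
    linarith

theorem sub_le_norm {n : ℕ} (x : MZ n) (i j : Fin (n + 1)) : x.coord i - x.coord j ≤ 2 * ‖x‖ :=
  (norm_le_iff x _).1 le_rfl i j

theorem normCore (n : ℕ) : NormedSpace.Core ℝ (MZ n) where
  norm_nonneg x := by linarith [sub_le_norm x 0 0]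
  norm_smul c x := by
    have key : ∀ (d : ℝ) (y : MZ n), ‖d • y‖ ≤ ‖d‖ * ‖y‖ := by
      intro d y
      rw [norm_le_iff]
      intro i j
      rw [coord_smul, coord_smul, ← mul_sub, Real.norm_eq_abs]
      have h1 := sub_le_norm y i j
      have h2 := sub_le_norm y j i
      rcases abs_cases d with ⟨h, _⟩ | ⟨h, _⟩ <;> rw [h] <;> nlinarith
    apply le_antisymm (key c x)
    rcases eq_or_ne c 0 with rfl | hc
    · simp only [norm_zero, zero_mul, zero_smul]
      linarith [sub_le_norm (0 : MZ n) 0 0]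
    · have h := key c⁻¹ (c • x)
      rw [smul_smul, inv_mul_cancel₀ hc, one_smul, norm_inv] at h
      have hc' : 0 < ‖c‖ := norm_pos_iff.2 hc
      calc ‖c‖ * ‖x‖ ≤ ‖c‖ * (‖c‖⁻¹ * ‖c • x‖) := by gcongr
        _ = ‖c • x‖ := by field_simp
  norm_triangle x y := by
    rw [norm_le_iff]
    intro i j
    simp only [coord_add]
    linarith [sub_le_norm x i j, sub_le_norm y i j]
  norm_eq_zero_iff x := by
    constructor
    · intro h
      have hc : ∀ i j, x.coord i = x.coord j := fun i j => by
        linarith [sub_le_norm x i j, sub_le_norm x j i]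
      apply coord_ext
      intro i
      have hs := sum_coord x
      rw [Finset.sum_congr rfl (fun j _ => hc j i)] at hs
      simp only [Finset.sum_const, Finset.card_univ, Fintype.card_fin, nsmul_eq_mul,
        mul_eq_zero] at hs
      rcases hs with hs | hs
      · exact absurd hs (by positivity)
      · simpa using hs
    · rintro rfl
      simp [norm_def]

instance (n : ℕ) : NormedAddCommGroup (MZ n) := NormedAddCommGroup.ofCore (normCore n)

instance (n : ℕ) : NormedSpace ℝ (MZ n) := NormedSpace.ofCore (normCore n)

/-- The orthogonal projection `π` of `ℝ^{n+1}` onto `H`, with values in `M_Z^n`. -/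
def proj (n : ℕ) : EuclideanSpace ℝ (Fin (n + 1)) →ₗ[ℝ] MZ n :=
  (ofH n).toLinearMap ∘ₗ ((hyperplaneH n).orthogonalProjectionOnto).toLinearMap

/-- The zonotope `Z_n = π(B_∞^{n+1})`. -/
def zonotope (n : ℕ) : Set (MZ n) := proj n '' {x | ∀ i, |x i| ≤ 1}

theorem coord_proj {n : ℕ} (x : EuclideanSpace ℝ (Fin (n + 1))) (i : Fin (n + 1)) :
    (proj n x).coord i = x i - (∑ j, x j) / (n + 1) := by
  have hn : (n : ℝ) + 1 ≠ 0 := by positivity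
  let v : EuclideanSpace ℝ (Fin (n + 1)) := WithLp.toLp 2 fun i => x i - (∑ j, x j) / (n + 1)
  have hv : v ∈ hyperplaneH n := by
    change ∑ i, (x i - (∑ j, x j) / (n + 1)) = 0
    rw [Finset.sum_sub_distrib]
    simp only [Finset.sum_const, Finset.card_univ, Fintype.card_fin, nsmul_eq_mul]
    push_cast
    field_simp
    ring
  have h : (hyperplaneH n).starProjection x = v := by
    apply Submodule.eq_starProjection_of_mem_of_inner_eq_zero hv
    intro w hw
    have hw' : ∑ i, w i = 0 := hw
    simp [PiLp.inner_apply, v, ← Finset.sum_mul, hw']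
  have h2 : (proj n x).coord i = ((hyperplaneH n).starProjection x) i := rfl
  rw [h2, h]

/-- The unit ball of `M_Z^n` is the zonotope `Z_n`. -/
theorem closedBall_eq_zonotope (n : ℕ) : Metric.closedBall (0 : MZ n) 1 = zonotope n := by
  ext x
  rw [mem_closedBall_zero_iff, norm_le_iff]
  constructor
  · intro h
    have hb : (⨆ i, x.coord i) - (⨅ i, x.coord i) ≤ 2 := by
      have := (norm_le_iff x 1).2 h
      rw [norm_def] at this
      linarith
    set m : ℝ := ((⨆ i, x.coord i) + ⨅ i, x.coord i) / 2 with hm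
    refine ⟨WithLp.toLp 2 fun i => x.coord i - m, ?_, ?_⟩
    · intro i
      change |x.coord i - m| ≤ 1
      rw [abs_le]
      constructor <;> linarith [coord_le x i, le_coord x i]
    · apply coord_ext
      intro i
      rw [coord_proj]
      have hn : (n : ℝ) + 1 ≠ 0 := by positivity
      simp only [Finset.sum_sub_distrib, sum_coord, Finset.sum_const, Finset.card_univ,
        Fintype.card_fin, nsmul_eq_mul]
      push_cast
      field_simp
      ring
  · rintro ⟨y, hy, rfl⟩ i j
    rw [coord_proj, coord_proj]
    linarith [(abs_le.1 (hy i)).2, (abs_le.1 (hy j)).1]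

end MZ

/-! ### Signed sets and the faces of the zonotope -/

/-- Signed subsets of an `m`-element set: vectors in `{0, ±1}^m`. -/
abbrev SignedSet (m : ℕ) : Type := Fin m → SignType

/-- The positive part `X⁺` of a signed set. -/
def SignedSet.pos {m : ℕ} (X : SignedSet m) : Set (Fin m) := {i | X i = 1}

/-- The negative part `X⁻` of a signed set. -/
def SignedSet.neg {m : ℕ} (X : SignedSet m) : Set (Fin m) := {i | X i = -1}

/-- The support of a vector, as a signed set. -/
def signedSupport {m : ℕ} (x : EuclideanSpace ℝ (Fin m)) : SignedSet m :=
  fun i => SignType.sign (x i)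

/-- The set `supp(H)` of the supports of the vectors in `H`; it indexes the non-empty faces of
the zonotope `Z_n`. -/
def covectorsH (n : ℕ) : Set (SignedSet (n + 1)) :=
  signedSupport '' (hyperplaneH n : Set (EuclideanSpace ℝ (Fin (n + 1))))

/-- The face `F(X) = ∑_{i ∈ X⁺} π(e_i) - ∑_{j ∈ X⁻} π(e_j) + ∑_{k ∈ X⁰} [-π(e_k), π(e_k)]` of the
zonotope `Z_n`, a Minkowski sum of points and segments. -/
def zonotopeFace (n : ℕ) (X : SignedSet (n + 1)) : Set (MZ n) :=
  ∑ i, if X i = 1 then {MZ.proj n (EuclideanSpace.single i 1)}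
    else if X i = -1 then {-MZ.proj n (EuclideanSpace.single i 1)}
    else segment ℝ (-MZ.proj n (EuclideanSpace.single i 1)) (MZ.proj n (EuclideanSpace.single i 1))

end

/-! The star has length `∑ ‖p i‖`, so everything rests on comparing this number with the length of
an arbitrary tree. The functionals `x ↦ (x i - x j) / 2` have norm at most 1, and those with `i ∈
X_a⁺`, `j ∈ X_b⁻` are exactly what the sign data of the terminals provide.

Lower bound: any piece of a tree, with terminals `S` and hanging at `x`, has length at least `∑_S ‖p
s‖ - (x i - x j) / 2` for some `a, b ∈ S` and all `i ∈ X_a⁺`, `j ∈ X_b⁻` (`HangingBound`). Two such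
bounds with pairs `(a, b)` and `(c, d)` combine by telescoping through a coordinate common to `X_a⁺
∪ X_c⁺` and `X_b⁻ ∪ X_d⁻` (`HangingBound.merge`). Collecting the tree at `o`, where coordinate
differences vanish, gives the bound (`bound_of_connected`).

Upper bound: if no common coordinate exists for some `a, b, c, d`, three Steiner points near `o`
save `4t` on the terminals at a cost of at most `3t` (`exists_isSteinerTree_lt_of_not_isLinked`).

The criterion involves at most four indices at a time, hence the second equivalence. -/

/-- The distance between the positions `f x`, `f y` of the ends of an edge `xy`. -/
noncomputable def edgeDist {E V : Type*} [NormedAddCommGroup E] (f : V → E) : Sym2 V → ℝ :=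
  Sym2.lift ⟨fun x y : V => ‖f x - f y‖, fun _ _ => norm_sub_rev _ _⟩

open Classical in
/-- The sum of the distances `‖f x - f y‖` over the edges `xy` of a finite graph whose vertices are
placed in a normed space by `f`. -/
noncomputable def edgeSum {E V : Type*} [NormedAddCommGroup E] [Fintype V] (f : V → E) (G : SimpleGraph V) : ℝ :=
  ∑ e ∈ G.edgeFinset, edgeDist f e

theorem graphLength_eq_edgeSum {E : Type*} [NormedAddCommGroup E] {V : Finset E}
    (G : SimpleGraph V) : graphLength G = edgeSum (fun x : V => (x : E)) G := by
  classical
  unfold graphLength edgeSum edgeDist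
  congr!

/-! ### Edge sums of graphs, and transport of bounds along them -/

section edgeSum

variable {E : Type*} [NormedAddCommGroup E]

theorem edgeDist_nonneg {V : Type*} (f : V → E) (e : Sym2 V) :
    0 ≤ edgeDist f e := by
  induction e using Sym2.ind with
  | _ x y => exact norm_nonneg (f x - f y)

theorem edgeSum_nonneg {V : Type*} [Fintype V] (f : V → E) (G : SimpleGraph V) :
    0 ≤ edgeSum f G :=
  Finset.sum_nonneg fun e _ => edgeDist_nonneg f e

theorem edgeSum_mono {V : Type*} [Fintype V] (f : V → E) {G G' : SimpleGraph V} (h : G ≤ G') :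
    edgeSum f G ≤ edgeSum f G' := by
  classical
  exact Finset.sum_le_sum_of_subset_of_nonneg (SimpleGraph.edgeFinset_mono h)
    fun e _ _ => edgeDist_nonneg f e

/-- Only an inequality, since `l` need not be a leaf: its other edges are discarded. -/
theorem edgeSum_induce_compl_add_le {V : Type*} [Fintype V] (f : V → E) (G : SimpleGraph V)
    {l u : V} [Fintype ({l}ᶜ : Set V)] (h : G.Adj l u) :
    edgeSum (fun x : ({l}ᶜ : Set V) => f x) (G.induce {l}ᶜ) + ‖f u - f l‖ ≤ edgeSum f G := by
  classical
  have hinj : Function.Injective (Sym2.map (Subtype.val : ({l}ᶜ : Set V) → V)) :=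
    Sym2.map.injective Subtype.val_injective
  have hl : s(u, l) ∉ (G.induce {l}ᶜ).edgeFinset.image (Sym2.map Subtype.val) := by
    rw [Finset.mem_image]
    rintro ⟨e, -, he⟩
    have : l ∈ Sym2.map (Subtype.val : ({l}ᶜ : Set V) → V) e := he ▸ Sym2.mem_mk_right u l
    obtain ⟨x, -, hx⟩ := Sym2.mem_map.1 this
    exact x.2 hx
  have hsub : insert s(u, l) ((G.induce {l}ᶜ).edgeFinset.image (Sym2.map Subtype.val))
      ⊆ G.edgeFinset := by
    rw [Finset.insert_subset_iff]
    refine ⟨by simpa using h.symm, ?_⟩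
    intro e he
    obtain ⟨e', he', rfl⟩ := Finset.mem_image.1 he
    induction e' using Sym2.ind with
    | _ x y => simpa using he'
  have hle := Finset.sum_le_sum_of_subset_of_nonneg
    (f := edgeDist f) hsub
    fun e _ _ => edgeDist_nonneg f e
  rw [Finset.sum_insert hl, Finset.sum_image hinj.injOn] at hle
  have heq : edgeSum (fun x : ({l}ᶜ : Set V) => f x) (G.induce {l}ᶜ) =
      ∑ e ∈ (G.induce {l}ᶜ).edgeFinset, edgeDist f (Sym2.map Subtype.val e) := by
    unfold edgeSum
    refine Finset.sum_congr (by congr!) fun e _ => ?_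
    induction e using Sym2.ind with
    | _ x y => rfl
  rw [heq, add_comm]
  exact hle

theorem edgeSum_fromEdgeSet_le {V J : Type*} [Fintype V] [Fintype J] (f : V → E) (s t : J → V) :
    edgeSum f (SimpleGraph.fromEdgeSet (Set.range fun j => s(s j, t j))) ≤
      ∑ j, ‖f (s j) - f (t j)‖ := by
  classical
  unfold edgeSum
  calc _ ≤ ∑ e ∈ Finset.univ.image (fun j => s(s j, t j)), edgeDist f e := by
        refine Finset.sum_le_sum_of_subset_of_nonneg ?_ fun e _ _ => edgeDist_nonneg f e
        intro e he
        simp only [SimpleGraph.mem_edgeFinset, SimpleGraph.edgeSet_fromEdgeSet] at he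
        simpa using he.1
    _ ≤ _ := Finset.sum_image_le_of_nonneg fun e _ => edgeDist_nonneg f e

theorem Fintype.sum_compl_singleton_add {V M : Type*} [Fintype V] [AddCommMonoid M] (l : V)
    [Fintype ({l}ᶜ : Set V)] (g : V → M) : (∑ v : ({l}ᶜ : Set V), g v) + g l = ∑ v, g v := by
  classical
  rw [Fintype.sum_eq_add_sum_subtype_ne g l, add_comm]
  congr 1
  exact @Fintype.sum_equiv _ _ _ _ (_) _ (Equiv.refl _) _ _ fun _ => rfl

/-- A bound that is additive at a point and survives moving along a segment at the cost of its
length can be transported along a connected graph to any of its vertices. -/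
theorem bound_of_connected {ι : Type*} (Q : E → Multiset ι → ℝ → Prop)
    (move : ∀ x y S w, Q x S w → Q y S (w + ‖x - y‖))
    (merge : ∀ x S w S' w', Q x S w → Q x S' w' → Q x (S + S') (w + w'))
    (mono : ∀ x S w w', Q x S w → w ≤ w' → Q x S w') (m : ℕ) :
    ∀ (V : Type*) [Fintype V] (_ : Fintype.card V = m) (G : SimpleGraph V) (_ : G.Connected)
      (f : V → E) (S : V → Multiset ι) (w : V → ℝ) (_ : ∀ v, Q (f v) (S v) (w v)) (r : V),
      Q (f r) (∑ v, S v) (∑ v, w v + edgeSum f G) := by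
  classical
  induction m with
  | zero =>
    intro V _ hc G _ f S w _ r
    exact absurd hc (Fintype.card_pos_iff.2 ⟨r⟩).ne'
  | succ m ih =>
    intro V _ hc G hG f S w hQ r
    rcases subsingleton_or_nontrivial V with hV | hV
    · rw [Fintype.sum_subsingleton _ r, Fintype.sum_subsingleton _ r]
      exact mono _ _ _ _ (hQ r) (by linarith [edgeSum_nonneg f G])
    -- Remove a vertex that does not disconnect the graph and load its data onto a neighbour `u`,
    -- paying for the edge `ul`.
    · obtain ⟨l, hl⟩ := hG.exists_connected_induce_compl_singleton_of_finite_nontrivial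
      obtain ⟨u, hu⟩ := hG.preconnected.exists_adj_of_nontrivial l
      have hcard : Fintype.card ({l}ᶜ : Set V) = m := by
        rw [Fintype.card_compl_set, hc]
        simp
      have hE := edgeSum_induce_compl_add_le f G hu
      have hul : u ∈ ({l}ᶜ : Set V) := hu.ne'
      by_cases hr : r = l
      -- If the root itself is removed, collect at `u` first and move to the root at the end.
      · subst hr
        have h1 := ih _ hcard _ hl (fun x => f x) (fun x => S x) (fun x => w x)
          (fun v => hQ v) ⟨u, hul⟩
        have h2 := merge _ _ _ _ _ (move _ (f r) _ _ h1) (hQ r)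
        rw [Fintype.sum_compl_singleton_add r S] at h2
        refine mono _ _ _ _ h2 ?_
        rw [← Fintype.sum_compl_singleton_add r w]
        simp only at hE ⊢
        linarith
      · have h1 := ih _ hcard _ hl (fun x => f x)
          (fun x => S x + if x = ⟨u, hul⟩ then S l else 0)
          (fun x => w x + if x = ⟨u, hul⟩ then w l + ‖f l - f u‖ else 0) (fun v => by
            by_cases hv : v = ⟨u, hul⟩
            · subst hv
              simpa using merge _ _ _ _ _ (hQ u) (move _ (f u) _ _ (hQ l))
            · simpa [hv] using hQ v) ⟨r, hr⟩
        rw [Finset.sum_add_distrib, Finset.sum_add_distrib, Finset.sum_ite_eq',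
          Finset.sum_ite_eq', if_pos (Finset.mem_univ _), if_pos (Finset.mem_univ _),
          Fintype.sum_compl_singleton_add l S] at h1
        refine mono _ _ _ _ h1 ?_
        rw [← Fintype.sum_compl_singleton_add l w, norm_sub_rev (f l)]
        linarith

end edgeSum

/-! ### Length of the star, and competing trees -/

section steiner

variable {E : Type*} [NormedAddCommGroup E]

open Classical in
theorem isSteinerTree_star (P : Finset E) :
    IsSteinerTree (insert 0 P) (insert 0 P) (starAtOrigin P) :=
  ⟨subset_rfl, SimpleGraph.isTree_starGraph _⟩

open Classical in
theorem graphLength_starAtOrigin_le (P : Finset E) :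
    graphLength (starAtOrigin P) ≤ ∑ x ∈ P, ‖x‖ := by
  rw [graphLength_eq_edgeSum, ← Finset.sum_coe_sort P]
  have h := edgeSum_fromEdgeSet_le (fun x : (insert 0 P : Finset E) => (x : E))
    (fun j : P => ⟨j, Finset.mem_insert_of_mem j.2⟩) (fun _ => ⟨0, Finset.mem_insert_self 0 P⟩)
  simp only [sub_zero] at h
  refine le_trans (edgeSum_mono _ ?_) h
  intro x y hxy
  rw [starAtOrigin, SimpleGraph.starGraph_adj] at hxy
  obtain ⟨hne, hxy⟩ := hxy
  rw [SimpleGraph.fromEdgeSet_adj]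
  refine ⟨?_, hne⟩
  rcases hxy with rfl | rfl
  · refine ⟨⟨y, (Finset.mem_insert.1 y.2).resolve_left fun h => hne (Subtype.ext h.symm)⟩, ?_⟩
    exact Sym2.eq_swap
  · exact ⟨⟨x, (Finset.mem_insert.1 x.2).resolve_left fun h => hne (Subtype.ext h)⟩, rfl⟩

-- With `0 ∉ P` the edges of the star are distinct and none is a loop, so no term is lost.
open Classical in
theorem sum_norm_le_graphLength_starAtOrigin (P : Finset E) (h0 : (0 : E) ∉ P) :
    ∑ x ∈ P, ‖x‖ ≤ graphLength (starAtOrigin P) := by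
  rw [graphLength_eq_edgeSum, ← Finset.sum_coe_sort P, edgeSum]
  let g : P → Sym2 (insert 0 P : Finset E) := fun j =>
    s(⟨j, Finset.mem_insert_of_mem j.2⟩, ⟨0, Finset.mem_insert_self 0 P⟩)
  have hg : Function.Injective g := by
    intro x y hxy
    simp only [g, Sym2.eq_iff, Subtype.mk.injEq] at hxy
    rcases hxy with hxy | hxy
    · exact Subtype.ext hxy.1
    · exact absurd (hxy.1 ▸ x.2) h0
  calc ∑ x : P, ‖(x : E)‖ = ∑ e ∈ Finset.univ.image g, 
        edgeDist (fun x : (insert 0 P : Finset E) => (x : E)) e := by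
        rw [Finset.sum_image hg.injOn]
        simp [g, edgeDist]
    _ ≤ _ := by
        refine Finset.sum_le_sum_of_subset_of_nonneg ?_
          fun e _ _ => edgeDist_nonneg (fun x : (insert 0 P : Finset E) => (x : E)) e
        intro e he
        obtain ⟨j, -, rfl⟩ := Finset.mem_image.1 he
        rw [SimpleGraph.mem_edgeFinset, SimpleGraph.mem_edgeSet, starAtOrigin,
          SimpleGraph.starGraph_adj]
        refine ⟨fun h => h0 ?_, Or.inr rfl⟩
        have hj : (j : E) = 0 := Subtype.ext_iff.1 h
        exact hj ▸ j.2

open Classical in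
/-- Terminals `p i` joined to one of the points `0`, `z₁`, `z₂`, with `z₁` and `z₂` joined to `z₃`
and `z₃` to `0`, span a Steiner tree. -/
theorem exists_isSteinerTree_le {ι : Type*} [Fintype ι] (p q : ι → E) (z₁ z₂ z₃ : E)
    (hq : ∀ i, q i = 0 ∨ q i = z₁ ∨ q i = z₂) :
    ∃ (V : Finset E) (G : SimpleGraph V), IsSteinerTree (insert 0 (Finset.univ.image p)) V G ∧
      graphLength G ≤ ∑ i, ‖p i - q i‖ + (‖z₁ - z₃‖ + ‖z₂ - z₃‖ + ‖z₃‖) := by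
  let V : Finset E := insert 0 (insert z₁ (insert z₂ (insert z₃ (Finset.univ.image p))))
  have h0 : 0 ∈ V := by simp [V]
  have h1 : z₁ ∈ V := by simp [V]
  have h2 : z₂ ∈ V := by simp [V]
  have h3 : z₃ ∈ V := by simp [V]
  have hpV : ∀ i, p i ∈ V := fun i => by simp [V]
  have hqV : ∀ i, q i ∈ V := fun i => by rcases hq i with h | h | h <;> rw [h] <;> assumption
  let s : ι ⊕ Fin 3 → V := Sum.elim (fun i => ⟨p i, hpV i⟩) ![⟨z₁, h1⟩, ⟨z₂, h2⟩, ⟨z₃, h3⟩]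
  let t : ι ⊕ Fin 3 → V := Sum.elim (fun i => ⟨q i, hqV i⟩) ![⟨z₃, h3⟩, ⟨z₃, h3⟩, ⟨0, h0⟩]
  let G : SimpleGraph V := SimpleGraph.fromEdgeSet (Set.range fun j => s(s j, t j))
  have hst : ∀ j, G.Reachable (s j) (t j) := by
    intro j
    by_cases h : s j = t j
    · rw [h]
    · exact SimpleGraph.Adj.reachable ((SimpleGraph.fromEdgeSet_adj _).2 ⟨⟨j, rfl⟩, h⟩)
  have r3 : G.Reachable ⟨z₃, h3⟩ ⟨0, h0⟩ := hst (Sum.inr 2)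
  have r1 : G.Reachable ⟨z₁, h1⟩ ⟨0, h0⟩ := (hst (Sum.inr 0)).trans r3
  have r2 : G.Reachable ⟨z₂, h2⟩ ⟨0, h0⟩ := (hst (Sum.inr 1)).trans r3
  have rq : ∀ i, G.Reachable ⟨q i, hqV i⟩ ⟨0, h0⟩ := by
    intro i
    rcases hq i with h | h | h <;> simp only [h]
    · exact SimpleGraph.Reachable.refl _
    · exact r1
    · exact r2
  have rp : ∀ i, G.Reachable ⟨p i, hpV i⟩ ⟨0, h0⟩ := fun i => (hst (Sum.inl i)).trans (rq i)
  have hr : ∀ x : V, G.Reachable x ⟨0, h0⟩ := by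
    rintro ⟨x, hx⟩
    have hx' := hx
    simp only [V, Finset.mem_insert, Finset.mem_image, Finset.mem_univ, true_and] at hx'
    rcases hx' with rfl | rfl | rfl | rfl | ⟨i, rfl⟩
    · exact SimpleGraph.Reachable.refl _
    · exact r1
    · exact r2
    · exact r3
    · exact rp i
  have hG : G.Connected :=
    (SimpleGraph.connected_iff _).2 ⟨fun x y => (hr x).trans (hr y).symm, ⟨⟨0, h0⟩⟩⟩
  -- The listed points may coincide, so the graph may contain cycles; a spanning tree is no longer
  -- than it.
  obtain ⟨T, hT, hTree⟩ := hG.exists_isTree_le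
  refine ⟨V, T, ⟨?_, hTree⟩, ?_⟩
  · intro x hx
    simp only [Finset.mem_insert, Finset.mem_image, Finset.mem_univ, true_and] at hx
    rcases hx with rfl | ⟨i, rfl⟩
    · exact h0
    · exact hpV i
  · rw [graphLength_eq_edgeSum]
    refine (edgeSum_mono _ hT).trans ((edgeSum_fromEdgeSet_le _ s t).trans (le_of_eq ?_))
    rw [Fintype.sum_sum_type, Fin.sum_univ_three]
    simp [s, t]

end steiner

/-! ### Faces of the zonotope and extremal coordinates -/

namespace MZ

theorem coord_sub {n : ℕ} (x y : MZ n) (i : Fin (n + 1)) :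
    (x - y).coord i = x.coord i - y.coord i := by simp [coord]

/-- The image in `M_Z^n` of a vector given by its coordinates. -/
noncomputable def ofFun {n : ℕ} (y : Fin (n + 1) → ℝ) : MZ n := proj n (WithLp.toLp 2 y)

theorem coord_ofFun_sub {n : ℕ} (y : Fin (n + 1) → ℝ) (i j : Fin (n + 1)) :
    (ofFun y).coord i - (ofFun y).coord j = y i - y j := by
  simp [ofFun, coord_proj]

theorem ofFun_eq_sum {n : ℕ} (y : Fin (n + 1) → ℝ) :
    ofFun y = ∑ i, y i • proj n (EuclideanSpace.single i 1) := by
  rw [ofFun]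
  simp_rw [← map_smul]
  rw [← map_sum]
  congr 1
  ext i
  simp [Pi.single_apply]

theorem norm_ofFun_le {n : ℕ} {y : Fin (n + 1) → ℝ} {r : ℝ} (hy : ∀ i, |y i| ≤ r) :
    ‖ofFun y‖ ≤ r := by
  rw [norm_le_iff]
  intro i j
  rw [coord_ofFun_sub]
  linarith [(abs_le.1 (hy i)).2, (abs_le.1 (hy j)).1]

theorem ofFun_sub {n : ℕ} (y z : Fin (n + 1) → ℝ) : ofFun y - ofFun z = ofFun (y - z) := by
  rw [ofFun, ofFun, ofFun, ← map_sub]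
  rfl

theorem norm_lt_of_coord_sub_lt {n : ℕ} {x : MZ n} {r : ℝ}
    (h : ∀ i j, x.coord i - x.coord j < 2 * r) : ‖x‖ < r := by
  obtain ⟨i, hi⟩ := exists_eq_ciSup_of_finite (f := x.coord)
  obtain ⟨j, hj⟩ := exists_eq_ciInf_of_finite (f := x.coord)
  rw [norm_def, ← hi, ← hj]
  linarith [h i j]

/-- The signed set `X` records the coordinates at which `x` is largest (`X⁺`) and those at which it
is smallest (`X⁻`). -/
structure IsExtremal {n : ℕ} (x : MZ n) (X : SignedSet (n + 1)) : Prop where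
  exists_pos : ∃ i, X i = 1
  exists_neg : ∃ j, X j = -1
  sub_eq : ∀ i j, X i = 1 → X j = -1 → x.coord i - x.coord j = 2 * ‖x‖
  sub_lt : ∀ i j, ¬ (X i = 1 ∧ X j = -1) → x.coord i - x.coord j < 2 * ‖x‖

theorem mem_segment_neg_self {E : Type*} [AddCommGroup E] [Module ℝ E] {e z : E} :
    z ∈ segment ℝ (-e) e ↔ ∃ t : ℝ, |t| ≤ 1 ∧ z = t • e := by
  constructor
  · rintro ⟨a, b, ha, hb, hab, rfl⟩
    refine ⟨b - a, abs_le.2 ⟨by linarith, by linarith⟩, ?_⟩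
    module
  · rintro ⟨t, ht, rfl⟩
    have := abs_le.1 ht
    refine ⟨(1 - t) / 2, (1 + t) / 2, by linarith, by linarith, by ring, ?_⟩
    module

theorem mem_zonotopeFace {n : ℕ} {X : SignedSet (n + 1)} {q : MZ n} :
    q ∈ zonotopeFace n X ↔ ∃ y : Fin (n + 1) → ℝ, (∀ i, |y i| ≤ 1) ∧ (∀ i, X i = 1 → y i = 1) ∧
      (∀ i, X i = -1 → y i = -1) ∧ q = ofFun y := by
  rw [zonotopeFace, Set.mem_fintype_sum]
  constructor
  · rintro ⟨g, hg, rfl⟩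
    have key : ∀ i, ∃ t : ℝ, |t| ≤ 1 ∧ (X i = 1 → t = 1) ∧ (X i = -1 → t = -1) ∧
        g i = t • proj n (EuclideanSpace.single i 1) := by
      intro i
      have h := hg i
      split_ifs at h with h1 h2
      · exact ⟨1, by simp, by simp, by simp [h1], by simpa using h⟩
      · exact ⟨-1, by simp, by simp [h2], by simp, by simpa using h⟩
      · obtain ⟨t, ht, h⟩ := mem_segment_neg_self.1 h
        exact ⟨t, ht, fun h => absurd h h1, fun h => absurd h h2, h⟩
    choose y h1 h2 h3 h4 using key
    exact ⟨y, h1, h2, h3, by rw [ofFun_eq_sum]; exact Finset.sum_congr rfl fun i _ => h4 i⟩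
  · rintro ⟨y, h1, h2, h3, rfl⟩
    refine ⟨fun i => y i • proj n (EuclideanSpace.single i 1), fun i => ?_, (ofFun_eq_sum y).symm⟩
    split_ifs with hp hn
    · simp [h2 i hp]
    · simp [h3 i hn]
    · exact mem_segment_neg_self.2 ⟨y i, h1 i, rfl⟩

/-- A point of the relative interior of a set can be moved a little further away from any point of
the set. -/
theorem exists_lineMap_mem_of_mem_intrinsicInterior {E : Type*} [NormedAddCommGroup E]
    [NormedSpace ℝ E] {s : Set E} {c q : E} (hc : c ∈ s) (hq : q ∈ intrinsicInterior ℝ s) :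
    ∃ t : ℝ, 1 < t ∧ AffineMap.lineMap c q t ∈ s := by
  obtain ⟨y, hy, rfl⟩ := mem_intrinsicInterior.1 hq
  let g : ℝ → affineSpan ℝ s := fun t =>
    ⟨AffineMap.lineMap c (y : E) t, AffineMap.lineMap_mem t (subset_affineSpan ℝ s hc) y.2⟩
  have hg : Continuous g := by
    refine Continuous.subtype_mk ?_ _
    exact AffineMap.lineMap_continuous
  have hg1 : g 1 = y := Subtype.ext (by simp [g])
  have hev : ∀ᶠ t in nhds (1 : ℝ), g t ∈ interior ((↑) ⁻¹' s : Set (affineSpan ℝ s)) :=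
    hg.continuousAt.eventually (by rw [hg1]; exact isOpen_interior.mem_nhds hy)
  have hev' : ∀ᶠ t in nhdsWithin (1 : ℝ) (Set.Ioi 1),
      g t ∈ interior ((↑) ⁻¹' s : Set (affineSpan ℝ s)) :=
    hev.filter_mono nhdsWithin_le_nhds
  obtain ⟨t, ht, ht1⟩ := (hev'.and self_mem_nhdsWithin).exists
  exact ⟨t, ht1, (interior_subset ht : g t ∈ _)⟩

/-- Pushing `q` slightly away from the centre of the face stays in the face; pulling back shrinks
the free coordinates strictly inside `(-1, 1)`. -/
theorem exists_of_mem_intrinsicInterior_zonotopeFace {n : ℕ} {X : SignedSet (n + 1)} {q : MZ n}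
    (hq : q ∈ intrinsicInterior ℝ (zonotopeFace n X)) :
    ∃ y : Fin (n + 1) → ℝ, (∀ i, X i = 1 → y i = 1) ∧ (∀ i, X i = -1 → y i = -1) ∧
      (∀ i, X i ≠ 1 → y i < 1) ∧ (∀ i, X i ≠ -1 → -1 < y i) ∧ q = ofFun y := by
  -- The centre of the face: every free coordinate is 0.
  let c : Fin (n + 1) → ℝ := fun i => (X i : ℝ)
  have hc : ofFun c ∈ zonotopeFace n X := by
    refine mem_zonotopeFace.2 ⟨c, fun i => ?_, fun i hi => ?_, fun i hi => ?_, rfl⟩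
    · rcases SignType.trichotomy (X i) with h | h | h <;> simp [c, h]
    · simp [c, hi]
    · simp [c, hi]
  obtain ⟨t, ht, hmem⟩ := exists_lineMap_mem_of_mem_intrinsicInterior hc hq
  obtain ⟨y, h1, h2, h3, h4⟩ := mem_zonotopeFace.1 hmem
  have ht0 : (0 : ℝ) < t := by linarith
  have hlt : ∀ i, (1 - t⁻¹) * c i + t⁻¹ * y i = c i + t⁻¹ * (y i - c i) := fun i => by ring
  have hti : 0 < t⁻¹ := inv_pos.2 ht0
  have hti1 : t⁻¹ < 1 := inv_lt_one_of_one_lt₀ ht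
  refine ⟨fun i => c i + t⁻¹ * (y i - c i), fun i hi => ?_, fun i hi => ?_, fun i hi => ?_,
    fun i hi => ?_, ?_⟩
  · simp [c, hi, h2 i hi]
  · simp [c, hi, h3 i hi]
  · have hy := abs_le.1 (h1 i)
    rcases SignType.trichotomy (X i) with h | h | h
    · simp [c, h, h3 i h]
    · simp only [c, h, SignType.coe_zero]
      nlinarith
    · exact absurd h hi
  · have hy := abs_le.1 (h1 i)
    rcases SignType.trichotomy (X i) with h | h | h
    · exact absurd h hi
    · simp only [c, h, SignType.coe_zero]
      nlinarith
    · simp [c, h, h2 i h]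
  · have e : ofFun (fun i => c i + t⁻¹ * (y i - c i)) = ofFun c + t⁻¹ • (ofFun y - ofFun c) := by
      rw [ofFun_sub, ofFun, ofFun, ofFun, ← map_smul, ← map_add]
      rfl
    rw [e, ← h4, AffineMap.lineMap_apply_module']
    rw [add_sub_cancel_right, smul_smul, inv_mul_cancel₀ ht0.ne', one_smul]
    abel

theorem IsExtremal.of_mem_intrinsicInterior {n : ℕ} {X : SignedSet (n + 1)} {x : MZ n}
    (hx : x ≠ 0) (h : ‖x‖⁻¹ • x ∈ intrinsicInterior ℝ (zonotopeFace n X)) : IsExtremal x X := by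
  obtain ⟨y, h1, h2, h3, h4, hy⟩ := exists_of_mem_intrinsicInterior_zonotopeFace h
  have hpos : 0 < ‖x‖ := norm_pos_iff.2 hx
  have hsub : ∀ i j, x.coord i - x.coord j = ‖x‖ * (y i - y j) := by
    intro i j
    rw [← coord_ofFun_sub y, ← hy, coord_smul, coord_smul]
    field_simp
  have le1 : ∀ i, y i ≤ 1 := fun i => by
    by_cases hi : X i = 1
    · exact (h1 i hi).le
    · exact (h3 i hi).le
  have ge1 : ∀ i, -1 ≤ y i := fun i => by
    by_cases hi : X i = -1
    · exact (h2 i hi).ge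
    · exact (h4 i hi).le
  have hlt : ∀ i j, ¬ (X i = 1 ∧ X j = -1) → x.coord i - x.coord j < 2 * ‖x‖ := by
    intro i j hij
    have : y i - y j < 2 := by
      by_cases hi : X i = 1
      · linarith [le1 i, h4 j fun hj => hij ⟨hi, hj⟩]
      · linarith [ge1 j, h3 i hi]
    rw [hsub]
    nlinarith
  refine ⟨?_, ?_, fun i j hi hj => ?_, hlt⟩
  -- The norm is attained at some pair of coordinates, so not all pairs can be strict.
  · by_contra hne
    exact lt_irrefl _ (norm_lt_of_coord_sub_lt fun i j => hlt i j fun hij => hne ⟨i, hij.1⟩)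
  · by_contra hne
    exact lt_irrefl _ (norm_lt_of_coord_sub_lt fun i j => hlt i j fun hij => hne ⟨j, hij.2⟩)
  · rw [hsub, h1 i hi, h2 j hj]
    ring

/-- To first order, moving away from `x` in a direction which increases the range of the extremal
coordinates by `2 * g` decreases the norm by `g`. -/
theorem IsExtremal.eventually_norm_sub_le {n : ℕ} {X : SignedSet (n + 1)} {x : MZ n}
    (hx : IsExtremal x X) (v : Fin (n + 1) → ℝ) (g : ℝ)
    (hv : ∀ i j, X i = 1 → X j = -1 → 2 * g ≤ v i - v j) :
    ∀ᶠ t in nhdsWithin (0 : ℝ) (Set.Ioi 0), ‖x - t • ofFun v‖ ≤ ‖x‖ - t * g := by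
  simp_rw [norm_le_iff, Filter.eventually_all]
  intro i j
  have hc : ∀ t : ℝ, (x - t • ofFun v).coord i - (x - t • ofFun v).coord j =
      x.coord i - x.coord j - t * (v i - v j) := by
    intro t
    rw [← coord_ofFun_sub v, coord_sub, coord_sub, coord_smul, coord_smul]
    ring
  simp_rw [hc]
  by_cases hij : X i = 1 ∧ X j = -1
  · filter_upwards [self_mem_nhdsWithin] with t ht
    have ht : 0 < t := ht
    have := hv i j hij.1 hij.2
    rw [hx.sub_eq i j hij.1 hij.2]
    nlinarith
  -- Non-extremal pairs have slack, which survives for small `t` by continuity.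
  · have hlt := hx.sub_lt i j hij
    have h1 : Filter.Tendsto (fun t : ℝ => x.coord i - x.coord j - t * (v i - v j)) (nhds 0)
        (nhds (x.coord i - x.coord j - 0 * (v i - v j))) :=
      Continuous.tendsto (by fun_prop) 0
    have h2 : Filter.Tendsto (fun t : ℝ => 2 * (‖x‖ - t * g)) (nhds 0)
        (nhds (2 * (‖x‖ - 0 * g))) :=
      Continuous.tendsto (by fun_prop) 0
    have := h1.eventually_lt h2 (by linarith)
    exact (this.mono fun t ht => ht.le).filter_mono nhdsWithin_le_nhds

end MZ

/-! ### Lower bound for linked signed sets -/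

namespace MZ

variable {n : ℕ} {ι : Type*}

/-- No indices `a, b, c, d` with `{a, b} ∩ {c, d} = ∅` have
`(X_a⁺ ∪ X_c⁺) ∩ (X_b⁻ ∪ X_d⁻) = ∅`. -/
def IsLinked (X : ι → SignedSet (n + 1)) : Prop :=
  ¬ ∃ a b c d : ι, ({a, b} : Set ι) ∩ {c, d} = ∅ ∧
    ((X a).pos ∪ (X c).pos) ∩ ((X b).neg ∪ (X d).neg) = ∅

theorem IsLinked.exists_common {X : ι → SignedSet (n + 1)} (h : IsLinked X) {a b c d : ι}
    (hac : a ≠ c) (had : a ≠ d) (hbc : b ≠ c) (hbd : b ≠ d) :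
    ∃ m, (X a m = 1 ∨ X c m = 1) ∧ (X b m = -1 ∨ X d m = -1) := by
  by_contra hne
  refine h ⟨a, b, c, d, ?_, ?_⟩
  · ext x
    simp only [Set.mem_inter_iff, Set.mem_insert_iff, Set.mem_singleton_iff, Set.mem_empty_iff_false,
      iff_false]
    rintro ⟨rfl | rfl, h1 | h1⟩ <;> contradiction
  · exact Set.eq_empty_of_forall_notMem fun m hm => hne ⟨m, hm⟩

/-- The lower bound `w` for the length of a tree hanging at `x` with set of terminals `S`, for a
suitable choice of norming functionals of the terminals. -/
def HangingBound (p : ι → MZ n) (X : ι → SignedSet (n + 1)) (x : MZ n) (S : Multiset ι) (w : ℝ) :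
    Prop :=
  S.Nodup → (S = 0 ∧ 0 ≤ w) ∨ ∃ a ∈ S, ∃ b ∈ S, ∀ i j, X a i = 1 → X b j = -1 →
    (S.map fun s => ‖p s‖).sum ≤ w + (x.coord i - x.coord j) / 2

theorem HangingBound.mono {p : ι → MZ n} {X : ι → SignedSet (n + 1)} {x : MZ n} {S : Multiset ι}
    {w w' : ℝ} (h : HangingBound p X x S w) (hw : w ≤ w') : HangingBound p X x S w' := by
  intro hS
  rcases h hS with ⟨h0, h1⟩ | ⟨a, ha, b, hb, h⟩
  · exact Or.inl ⟨h0, h1.trans hw⟩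
  · exact Or.inr ⟨a, ha, b, hb, fun i j hi hj => (h i j hi hj).trans (by linarith)⟩

theorem HangingBound.move {p : ι → MZ n} {X : ι → SignedSet (n + 1)} {x : MZ n} (y : MZ n)
    {S : Multiset ι} {w : ℝ} (h : HangingBound p X x S w) :
    HangingBound p X y S (w + ‖x - y‖) := by
  intro hS
  rcases h hS with ⟨h0, h1⟩ | ⟨a, ha, b, hb, h⟩
  · exact Or.inl ⟨h0, by positivity⟩
  · refine Or.inr ⟨a, ha, b, hb, fun i j hi hj => ?_⟩
    have h1 := h i j hi hj
    have h2 := sub_le_norm (x - y) i j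
    rw [coord_sub, coord_sub] at h2
    linarith

/-- The new pair consists of the two indices not used by the common coordinate `m`; instantiating
the old bounds at `m` makes its contribution cancel. -/
theorem HangingBound.merge {p : ι → MZ n} {X : ι → SignedSet (n + 1)} (hX : IsLinked X) {x : MZ n}
    {S S' : Multiset ι} {w w' : ℝ} (h : HangingBound p X x S w) (h' : HangingBound p X x S' w') :
    HangingBound p X x (S + S') (w + w') := by
  intro hS
  obtain ⟨hn, hn', hd⟩ := Multiset.nodup_add.1 hS
  rcases h hn with ⟨rfl, h1⟩ | ⟨a, ha, b, hb, h⟩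
  · rw [zero_add] at hS ⊢
    exact h'.mono (by linarith) hS
  rcases h' hn' with ⟨rfl, h1⟩ | ⟨c, hc, d, hd', h'⟩
  · rw [add_zero] at hS ⊢
    exact HangingBound.mono (fun _ => Or.inr ⟨a, ha, b, hb, h⟩) (by linarith) hS
  have hne : ∀ {s t}, s ∈ S → t ∈ S' → s ≠ t := by
    rintro s t hs ht rfl
    exact Multiset.disjoint_left.1 hd hs ht
  right
  simp only [Multiset.map_add, Multiset.sum_add]
  obtain ⟨m, h1 | h1, h2 | h2⟩ :=
    hX.exists_common (hne ha hc) (hne ha hd') (hne hb hc) (hne hb hd')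
  -- Here `m ∈ X_a⁺ ∩ X_b⁻`, so the first bound at `(m, m)` has no coordinate term.
  · refine ⟨c, by simp [hc], d, by simp [hd'], fun i j hi hj => ?_⟩
    linarith [h m m h1 h2, h' i j hi hj]
  -- Here `m ∈ X_a⁺ ∩ X_d⁻`: `(x m - x j) + (x i - x m)` telescopes.
  · refine ⟨c, by simp [hc], b, by simp [hb], fun i j hi hj => ?_⟩
    linarith [h m j h1 hj, h' i m hi h2]
  · refine ⟨a, by simp [ha], d, by simp [hd'], fun i j hi hj => ?_⟩
    linarith [h i m hi h2, h' m j h1 hj]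
  · refine ⟨a, by simp [ha], b, by simp [hb], fun i j hi hj => ?_⟩
    linarith [h i j hi hj, h' m m h1 h2]

open Classical in
theorem sum_norm_le_graphLength_of_isLinked [Fintype ι] {p : ι → MZ n} (hinj : Function.Injective p)
    {X : ι → SignedSet (n + 1)} (hext : ∀ i, IsExtremal (p i) (X i)) (hX : IsLinked X)
    {V : Finset (MZ n)} {G : SimpleGraph V}
    (hG : IsSteinerTree (insert 0 (Finset.univ.image p)) V G) :
    ∑ i, ‖p i‖ ≤ graphLength G := by
  obtain ⟨hV, hT⟩ := hG
  have h0 : (0 : MZ n) ∈ V := hV (Finset.mem_insert_self _ _)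
  have hpV : ∀ i, p i ∈ V := fun i => hV (by simp)
  -- Each vertex carries the index of the terminal located there, if any.
  let S : V → Multiset ι := fun v => ∑ i, if p i = v then {i} else 0
  have hS : ∑ v, S v = Finset.univ.val := by
    rw [Finset.sum_comm]
    have h1 : ∀ i : ι, (∑ v : V, if p i = v then ({i} : Multiset ι) else 0) = {i} := by
      intro i
      rw [Finset.sum_eq_single ⟨p i, hpV i⟩]
      · simp
      · intro v _ hv
        rw [if_neg]
        exact fun h => hv (Subtype.ext h.symm)
      · simp
    rw [Finset.sum_congr rfl fun i _ => h1 i, Finset.sum_multiset_singleton]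
  have hQ : ∀ v : V, HangingBound p X v (S v) 0 := by
    intro v _
    by_cases hv : ∃ i, p i = v
    · obtain ⟨i, hi⟩ := hv
      have hSv : S v = {i} := by
        simp only [S]
        rw [Finset.sum_eq_single i]
        · simp [hi]
        · intro j _ hj
          rw [if_neg]
          exact fun h => hj (hinj (h.trans hi.symm))
        · simp
      rw [hSv]
      refine Or.inr ⟨i, by simp, i, by simp, fun k l hk hl => ?_⟩
      have := (hext i).sub_eq k l hk hl
      rw [← hi]
      simp only [Multiset.map_singleton, Multiset.sum_singleton]
      linarith
    · refine Or.inl ⟨?_, le_rfl⟩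
      exact Finset.sum_eq_zero fun i _ => if_neg fun h => hv ⟨i, h⟩
  have key := bound_of_connected (HangingBound p X) (fun x y S w h => h.move y)
    (fun x S w S' w' h h' => h.merge hX h') (fun x S w w' h hw => h.mono hw) _ V rfl G hT.1
    (fun v => v) S (fun _ => 0) hQ ⟨0, h0⟩
  rw [hS, Finset.sum_const_zero, zero_add, ← graphLength_eq_edgeSum] at key
  rcases key Finset.univ.nodup with ⟨h1, h2⟩ | ⟨a, -, b, -, h⟩
  · rw [Finset.sum, h1]
    simpa using h2
  -- The bound now sits at the origin, so its coordinate term is zero.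
  · obtain ⟨i, hi⟩ := (hext a).exists_pos
    obtain ⟨j, hj⟩ := (hext b).exists_neg
    simpa using h i j hi hj

/-! ### A shorter tree for unlinked signed sets -/

/-- If `a ≠ b`, each terminal gains `t`; if `a = b`, the range along `v` is 4 and the single
terminal gains `2t`. -/
theorem IsExtremal.eventually_sum_pair_le [DecidableEq ι] {p : ι → MZ n} {X : ι → SignedSet (n + 1)}
    (hext : ∀ i, IsExtremal (p i) (X i)) (a b : ι) (v : Fin (n + 1) → ℝ)
    (hv : ∀ i, v i = (if X a i = 1 then 2 else 0) - (if X b i = -1 then 2 else 0))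
    (hdis : ∀ i, X a i = 1 → X b i = -1 → False) :
    ∀ᶠ t in nhdsWithin (0 : ℝ) (Set.Ioi 0),
      ∑ i ∈ {a, b}, ‖p i - t • ofFun v‖ ≤ ∑ i ∈ {a, b}, ‖p i‖ - 2 * t := by
  by_cases hab : a = b
  · subst hab
    have h := (hext a).eventually_norm_sub_le v 2 (fun i j hi hj => by
      rw [hv, hv]
      simp [hi, hj]
      norm_num)
    filter_upwards [h] with t ht
    simp only [Finset.pair_eq_singleton, Finset.sum_singleton]
    linarith
  · have ha := (hext a).eventually_norm_sub_le v 1 (fun i j hi hj => by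
      have hbi : X b i ≠ -1 := fun h => hdis i hi h
      rw [hv, hv, if_pos hi, if_neg hbi, hj, if_neg (by decide)]
      split_ifs <;> norm_num)
    have hb := (hext b).eventually_norm_sub_le v 1 (fun i j hi hj => by
      have haj : X a j ≠ 1 := fun h => hdis j h hj
      rw [hv, hv, if_pos hj, if_neg haj, hi, if_neg (show (1 : SignType) ≠ -1 by decide)]
      split_ifs <;> norm_num)
    filter_upwards [ha, hb] with t hta htb
    rw [Finset.sum_pair hab, Finset.sum_pair hab]
    linarith

open Classical in
theorem exists_isSteinerTree_lt_of_not_isLinked [Fintype ι] {p : ι → MZ n} {X : ι → SignedSet (n + 1)}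
    (hext : ∀ i, IsExtremal (p i) (X i)) (hX : ¬ IsLinked X) :
    ∃ (V : Finset (MZ n)) (G : SimpleGraph V),
      IsSteinerTree (insert 0 (Finset.univ.image p)) V G ∧ graphLength G < ∑ i, ‖p i‖ := by
  obtain ⟨a, b, c, d, hd, hU⟩ := not_not.1 hX
  have hdis : ∀ i, (X a i = 1 ∨ X c i = 1) → (X b i = -1 ∨ X d i = -1) → False :=
    fun i h1 h2 => (Set.eq_empty_iff_forall_notMem.1 hU i) ⟨h1, h2⟩
  have hd' : Disjoint ({a, b} : Finset ι) {c, d} := by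
    rw [Finset.disjoint_left]
    intro x hx hx'
    exact (Set.eq_empty_iff_forall_notMem.1 hd x) ⟨by simpa using hx, by simpa using hx'⟩
  -- `v₃` is half of `v₁ + v₂`, truncated to entries in `{0, ±1}`. Disjointness of the positive and
  -- negative unions keeps `v₁ - v₃` and `v₂ - v₃` in the unit cube.
  let v₁ : Fin (n + 1) → ℝ := fun i => (if X a i = 1 then 2 else 0) - (if X b i = -1 then 2 else 0)
  let v₂ : Fin (n + 1) → ℝ := fun i => (if X c i = 1 then 2 else 0) - (if X d i = -1 then 2 else 0)
  let v₃ : Fin (n + 1) → ℝ := fun i => (if X a i = 1 ∨ X c i = 1 then 1 else 0) -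
    (if X b i = -1 ∨ X d i = -1 then 1 else 0)
  have n1 : ‖ofFun v₁ - ofFun v₃‖ ≤ 1 := by
    rw [ofFun_sub]
    refine norm_ofFun_le fun i => ?_
    have := hdis i
    simp only [v₁, v₃, Pi.sub_apply]
    by_cases h1 : X a i = 1 <;> by_cases h2 : X c i = 1 <;> by_cases h3 : X b i = -1 <;>
      by_cases h4 : X d i = -1 <;> simp_all <;> norm_num
  have n2 : ‖ofFun v₂ - ofFun v₃‖ ≤ 1 := by
    rw [ofFun_sub]
    refine norm_ofFun_le fun i => ?_
    have := hdis i
    simp only [v₂, v₃, Pi.sub_apply]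
    by_cases h1 : X a i = 1 <;> by_cases h2 : X c i = 1 <;> by_cases h3 : X b i = -1 <;>
      by_cases h4 : X d i = -1 <;> simp_all <;> norm_num
  have n3 : ‖ofFun v₃‖ ≤ 1 := by
    refine norm_ofFun_le fun i => ?_
    simp only [v₃]
    split_ifs <;> norm_num
  have h1 := IsExtremal.eventually_sum_pair_le hext a b v₁ (fun _ => rfl)
    fun i hi hj => hdis i (Or.inl hi) (Or.inl hj)
  have h2 := IsExtremal.eventually_sum_pair_le hext c d v₂ (fun _ => rfl)
    fun i hi hj => hdis i (Or.inr hi) (Or.inr hj)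
  obtain ⟨t, ⟨ht1, ht2⟩, ht⟩ := ((h1.and h2).and self_mem_nhdsWithin).exists
  have ht : 0 < t := ht
  let q : ι → MZ n := fun i =>
    if i ∈ ({a, b} : Finset ι) then t • ofFun v₁
    else if i ∈ ({c, d} : Finset ι) then t • ofFun v₂ else 0
  obtain ⟨V, G, hG, hlen⟩ := exists_isSteinerTree_le p q (t • ofFun v₁) (t • ofFun v₂)
    (t • ofFun v₃) (fun i => by
      simp only [q]
      split_ifs <;> simp)
  refine ⟨V, G, hG, ?_⟩
  have hsplit : ∀ g : ι → ℝ, ∑ i, g i = ∑ i ∈ {a, b}, g i + ∑ i ∈ {c, d}, g i +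
      ∑ i ∈ (({a, b} : Finset ι) ∪ {c, d})ᶜ, g i := by
    intro g
    rw [← Finset.sum_union hd', Finset.sum_add_sum_compl]
  have e1 : ∑ i ∈ {a, b}, ‖p i - q i‖ = ∑ i ∈ {a, b}, ‖p i - t • ofFun v₁‖ :=
    Finset.sum_congr rfl fun i hi => by simp only [q]; rw [if_pos hi]
  have e2 : ∑ i ∈ {c, d}, ‖p i - q i‖ = ∑ i ∈ {c, d}, ‖p i - t • ofFun v₂‖ :=
    Finset.sum_congr rfl fun i hi => by
      simp only [q]
      rw [if_neg (Finset.disjoint_right.1 hd' hi), if_pos hi]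
  have e3 : ∑ i ∈ (({a, b} : Finset ι) ∪ {c, d})ᶜ, ‖p i - q i‖ =
      ∑ i ∈ (({a, b} : Finset ι) ∪ {c, d})ᶜ, ‖p i‖ :=
    Finset.sum_congr rfl fun i hi => by
      rw [Finset.mem_compl, Finset.mem_union, not_or] at hi
      simp only [q]
      rw [if_neg hi.1, if_neg hi.2, sub_zero]
  rw [hsplit] at hlen ⊢
  rw [e1, e2, e3, ← smul_sub, ← smul_sub, norm_smul, norm_smul, norm_smul, Real.norm_eq_abs,
    abs_of_pos ht] at hlen
  -- Savings of `2t + 2t` against connecting edges of total length at most `3t`.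
  nlinarith

open Classical in
theorem starIsSMT_image_iff [Fintype ι] {p : ι → MZ n} (hinj : Function.Injective p) (hp : ∀ i, p i ≠ 0)
    {X : ι → SignedSet (n + 1)} (hext : ∀ i, IsExtremal (p i) (X i)) :
    StarIsSMT (Finset.univ.image p) ↔ IsLinked X := by
  have hsum : ∑ x ∈ Finset.univ.image p, ‖x‖ = ∑ i, ‖p i‖ := Finset.sum_image hinj.injOn
  constructor
  · intro h
    by_contra hX
    obtain ⟨V, G, hG, hlt⟩ := exists_isSteinerTree_lt_of_not_isLinked hext hX
    have h1 := h.2 V G hG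
    have h2 := sum_norm_le_graphLength_starAtOrigin (Finset.univ.image p) (by simpa using hp)
    rw [hsum] at h2
    linarith
  · intro hX
    refine ⟨isSteinerTree_star _, fun V G hG => ?_⟩
    refine (graphLength_starAtOrigin_le _).trans ?_
    rw [hsum]
    exact sum_norm_le_graphLength_of_isLinked hinj hext hX hG

end MZ

/-! ### The criterion and its four-point form -/

open Classical in
theorem mainTheorem8 (n k : ℕ) (p : Fin k → MZ n) (hinj : Function.Injective p)
    (hp : ∀ i, p i ≠ 0) (X : Fin k → SignedSet (n + 1)) (hX : ∀ i, X i ∈ covectorsH n)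
    (hface : ∀ i, ‖p i‖⁻¹ • p i ∈ intrinsicInterior ℝ (zonotopeFace n (X i))) :
    (StarIsSMT (Finset.univ.image p) ↔
      ¬ ∃ a b c d : Fin k, ({a, b} : Set (Fin k)) ∩ {c, d} = ∅ ∧
        ((X a).pos ∪ (X c).pos) ∩ ((X b).neg ∪ (X d).neg) = ∅) ∧
    (StarIsSMT (Finset.univ.image p) ↔
      ∀ I : Finset (Fin k), 2 ≤ I.card → I.card ≤ 4 → StarIsSMT (I.image p)) := by
  have hext : ∀ i, MZ.IsExtremal (p i) (X i) := fun i =>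
    MZ.IsExtremal.of_mem_intrinsicInterior (hp i) (hface i)
  have hall := MZ.starIsSMT_image_iff hinj hp hext
  have hI : ∀ I : Finset (Fin k),
      StarIsSMT (I.image p) ↔ MZ.IsLinked fun i : I => X i := by
    intro I
    rw [← MZ.starIsSMT_image_iff (p := fun i : I => p i) (hinj.comp Subtype.val_injective)
      (fun i => hp i) (fun i => hext i)]
    have : I.image p = Finset.univ.image fun i : I => p i := by
      ext x
      simp
    rw [this]
  refine ⟨hall, ?_⟩
  rw [hall]
  constructor
  · intro h I _ _
    rw [hI]
    rintro ⟨a, b, c, d, hd, hU⟩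
    refine h ⟨a, b, c, d, ?_, hU⟩
    rw [← Set.image_pair, ← Set.image_pair, ← Set.image_inter Subtype.val_injective, hd,
      Set.image_empty]
  · rintro h ⟨a, b, c, d, hd, hU⟩
    have hac : a ≠ c := fun hac =>
      (Set.eq_empty_iff_forall_notMem.1 hd a) ⟨by simp, by simp [hac]⟩
    -- An obstruction lives on `{a, b, c, d}`, which has at least two elements because `a ≠ c`.
    refine (hI {a, b, c, d}).1 (h _ ?_ Finset.card_le_four)
      ⟨⟨a, by simp⟩, ⟨b, by simp⟩, ⟨c, by simp⟩, ⟨d, by simp⟩, ?_, hU⟩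
    · rw [← Finset.card_pair hac]
      exact Finset.card_le_card (by intro x; simp; tauto)
    · refine Set.image_injective.2 Subtype.val_injective ?_
      rw [Set.image_inter Subtype.val_injective, Set.image_pair, Set.image_pair, hd,
        Set.image_empty]
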